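/- Let $\mathcal E$ be a real separable Banach space and let $M$ be a connected, separable, metrizable $C^\infty$ Banach manifold modelled on $\mathcal E$. Let $\Delta=\{\delta(n)\}_{n=1}^\infty$ be a strictly increasing sequence of natural numbers. \textbf{Definitions.} A \emph{$\Delta$-flag} in a Banach space $\mathcal E'$ is a sequence of closed subspaces $E_n\subseteq\mathcal E'$ with $\dim E_n=\delta(n)$, $E_n\subset E_{n+1}$, $\bigcup_n E_n$ dense in $\mathcal E'$, and such that there are closed complements $E^{\infty-n}$ of $E_n$ in $\mathcal E'$ with $E^{\infty-n}\supseteq E^{\infty-(n+1)}$ for all $n$. A \emph{$\Delta$-filtration} of $M$ is a sequence $\mathcal F=\{M_n\}_{n=1}^\infty$ of nonempty finite-dimensional closed (embedded) submanifolds of $M$ such that for all $n\ge 1$: (a) $\dim M_n=\delta(n)$; (b) $M_n\subset M_{n+1}$; (c) if $M_\infty=\bigcup_n M_n$ carries the inductive limit topology, the inclusion $M_\infty\hookrightarrow M$ is a homotopy equivalence. It is \emph{normal} if moreover (d) for every $n$ the embeddings $M_n\hookrightarrow M_{n+1}$ and $M_n\hookrightarrow M$ have (smoothly) trivial normal bundles;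 (e) there are open tubular neighborhoods $V_n$ of $M_n$ in $M$ and open sets $U_n\subseteq V_n$ with $U_n\subseteq U_{n+1}$ and $M=\bigcup_n U_n$. (An open tubular neighborhood of $M_n$ is an open set $V_n\subseteq M$ that is the image of an open neighborhood of the zero section of a smooth vector bundle over $M_n$ under a diffeomorphism which restricts to the inclusion of $M_n$ on the zero section.) It is \emph{dense} if $M_\infty$ is dense in $M$, and \emph{Fredholm} if there are a Banach space $\mathcal E'$, a $\Delta$-flag $\{E_n\}$ of $\mathcal E'$ and a smooth map $f:M\to\mathcal E'$, all of whose differentials are Fredholm operators of index zero, such that for every $n$ the map $f$ is transverse to $E_n$ (that is, whenever $f(x)\in E_n$, one has $\operatorname{im} Df_x+E_n=\mathcal E'$ and $Df_x^{-1}(E_n)$ is complemented in $T_xM$) and $M_n=f^{-1}(E_n)$. \textbf{Lemma.} Let $\mathcal F=\{M_n\}_{n=1}^\infty$ be a normal $\Delta$-filtration of $M$, let $n_1<n_2<\cdots$ be a strictly increasing sequence of indices, and put $\tilde{\mathcal F}=\{M_{n_k}\}_{k=1}^\infty$ and $\tilde\Delta=\{\delta(n_k)\}_{k=1}^\infty$.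 Then $\tilde{\mathcal F}$ is a normal $\tilde\Delta$-filtration of $M$. If $\mathcal F$ is dense, then so is $\tilde{\mathcal F}$. If $\mathcal F$ is Fredholm (as a $\Delta$-filtration), then $\tilde{\mathcal F}$ is Fredholm (as a $\tilde\Delta$-filtration). -/

import Mathlib

open Set Topology Manifold Bundle
open scoped ContDiff

universe u v w

noncomputable section

/-! ### Closed submanifolds -/

/-- A closed (embedded, boundaryless) submanifold of finite dimension `dim` of a manifold `M`
modelled on `E`: a closed subset together with a smooth manifold structure, modelled on
`ℝ ^ dim` and inducing the subspace topology, for which the inclusion is a smooth embedding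
(in suitable charts it is the inclusion of a complemented subspace). -/
structure ClosedSubmanifold (E : Type u) [NormedAddCommGroup E] [NormedSpace ℝ E]
    (M : Type v) [TopologicalSpace M] [ChartedSpace E M] where
  carrier : Set M
  isClosed_carrier : IsClosed carrier
  dim : ℕ
  chartedSpace : ChartedSpace (EuclideanSpace ℝ (Fin dim)) carrier
  isManifold : IsManifold 𝓘(ℝ, EuclideanSpace ℝ (Fin dim)) ∞ carrier
  isSmoothEmbedding :
    IsSmoothEmbedding 𝓘(ℝ, EuclideanSpace ℝ (Fin dim)) 𝓘(ℝ, E) ∞ (Subtype.val : carrier → M)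

namespace ClosedSubmanifold

variable {E : Type u} [NormedAddCommGroup E] [NormedSpace ℝ E]
  {M : Type v} [TopologicalSpace M] [ChartedSpace E M]

/-- The model space `ℝ ^ dim` of a closed submanifold. -/
abbrev Model (S : ClosedSubmanifold E M) : Type := EuclideanSpace ℝ (Fin S.dim)

instance (S : ClosedSubmanifold E M) : ChartedSpace S.Model S.carrier := S.chartedSpace

instance (S : ClosedSubmanifold E M) : IsManifold 𝓘(ℝ, S.Model) ∞ S.carrier := S.isManifold

/-- The inclusion `S ↪ M`, as a smooth map. -/
def incl (S : ClosedSubmanifold E M) : C^∞⟮𝓘(ℝ, S.Model), S.carrier; 𝓘(ℝ, E), M⟯ :=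
  ⟨Subtype.val, S.isSmoothEmbedding.contMDiff⟩

/-- The inclusion `S ↪ T` of submanifolds `S ⊆ T` of `M`, as a smooth map. -/
def inclOfSubset {S T : ClosedSubmanifold E M} (h : S.carrier ⊆ T.carrier) :
    C^∞⟮𝓘(ℝ, S.Model), S.carrier; 𝓘(ℝ, T.Model), T.carrier⟯ :=
  ⟨Set.inclusion h, (ContMDiff.iff_comp_isImmersion T.isSmoothEmbedding.isImmersion).2
    ⟨continuous_inclusion h, S.isSmoothEmbedding.contMDiff⟩⟩

end ClosedSubmanifold

/-! ### Normal bundles -/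

section NormalBundle

variable {E₁ : Type w} [NormedAddCommGroup E₁] [NormedSpace ℝ E₁]
  {N₁ : Type*} [TopologicalSpace N₁] [ChartedSpace E₁ N₁]
  {E₂ : Type u} [NormedAddCommGroup E₂] [NormedSpace ℝ E₂]
  {N₂ : Type*} [TopologicalSpace N₂] [ChartedSpace E₂ N₂] [IsManifold 𝓘(ℝ, E₂) ∞ N₂]

/-- The tangential directions `df_x (T_x N₁) ⊆ T_{f x} N₂`. -/
abbrev tangentialRange (f : C^∞⟮𝓘(ℝ, E₁), N₁; 𝓘(ℝ, E₂), N₂⟯) (x : N₁) :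
    Submodule ℝ (TangentSpace 𝓘(ℝ, E₂) (f x)) :=
  LinearMap.range (mfderiv 𝓘(ℝ, E₁) 𝓘(ℝ, E₂) f x).toLinearMap

/-- The fibre `T_{f x} N₂ / df_x (T_x N₁)` at `x` of the normal bundle of `f`, with its quotient
topology. -/
abbrev NormalFibre (f : C^∞⟮𝓘(ℝ, E₁), N₁; 𝓘(ℝ, E₂), N₂⟯) (x : N₁) : Type u :=
  TangentSpace 𝓘(ℝ, E₂) (f x) ⧸ tangentialRange f x

/-- The quotient map `f^* T N₂ → ν(f)`, on the fibre of a point of the pullback bundle. -/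
def toNormalFibre (f : C^∞⟮𝓘(ℝ, E₁), N₁; 𝓘(ℝ, E₂), N₂⟯)
    (p : TotalSpace E₂ ((f : N₁ → N₂) *ᵖ (TangentSpace 𝓘(ℝ, E₂) : N₂ → Type u))) :
    NormalFibre f p.proj :=
  (tangentialRange f p.proj).mkQ p.snd

/-- The embedding `f` has trivial normal bundle: there is a global smooth trivialization
`ν(f) ≅ N₁ × F` for some Banach space `F`, i.e. a family of topological linear isomorphisms
`τ x : ν(f)_x ≃ F` that is smooth on `ν(f)`. The smooth structure of the quotient bundle `ν(f)`
is the one for which `f^* T N₂ → ν(f)` is a surjective submersion, so smoothness on `ν(f)` means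
smoothness after composition with this map. (The inverse `N₁ × F → ν(f)` is then smooth as well,
since inversion of bounded operators is smooth.) -/
def HasTrivialNormalBundle (f : C^∞⟮𝓘(ℝ, E₁), N₁; 𝓘(ℝ, E₂), N₂⟯) : Prop :=
  ∃ (F : Type u) (_ : NormedAddCommGroup F) (_ : NormedSpace ℝ F) (_ : CompleteSpace F)
    (τ : ∀ x : N₁, NormalFibre f x ≃L[ℝ] F),
    ContMDiff (𝓘(ℝ, E₁).prod 𝓘(ℝ, E₂)) 𝓘(ℝ, F) ∞
      (fun p : TotalSpace E₂ ((f : N₁ → N₂) *ᵖ (TangentSpace 𝓘(ℝ, E₂) : N₂ → Type u)) =>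
        τ p.proj (toNormalFibre f p))

end NormalBundle

/-! ### Tubular neighborhoods -/

/-- `V` is an open tubular neighborhood of `S` in `M`: there are a smooth vector bundle `B → S`,
an open neighborhood `Z` of its zero section and a diffeomorphism `Φ` of `Z` onto the open set `V`
which is the inclusion `S ↪ M` on the zero section. -/
def IsTubularNeighborhood {E : Type u} [NormedAddCommGroup E] [NormedSpace ℝ E]
    {M : Type v} [TopologicalSpace M] [ChartedSpace E M]
    (S : ClosedSubmanifold E M) (V : Set M) : Prop :=
  ∃ (F : Type u) (_ : NormedAddCommGroup F) (_ : NormedSpace ℝ F) (_ : CompleteSpace F)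
    (B : S.carrier → Type u)
    (_ : ∀ x, AddCommGroup (B x)) (_ : ∀ x, Module ℝ (B x)) (_ : ∀ x, TopologicalSpace (B x))
    (_ : TopologicalSpace (TotalSpace F B)) (_ : FiberBundle F B) (_ : VectorBundle ℝ F B)
    (_ : ContMDiffVectorBundle ∞ F B 𝓘(ℝ, S.Model))
    (Φ : OpenPartialHomeomorph (TotalSpace F B) M),
    Φ.target = V ∧
    ContMDiffOn (𝓘(ℝ, S.Model).prod 𝓘(ℝ, F)) 𝓘(ℝ, E) ∞ Φ Φ.source ∧
    ContMDiffOn 𝓘(ℝ, E) (𝓘(ℝ, S.Model).prod 𝓘(ℝ, F)) ∞ Φ.symm V ∧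
    ∀ x : S.carrier, (⟨x, 0⟩ : TotalSpace F B) ∈ Φ.source ∧ Φ ⟨x, 0⟩ = x

/-! ### Inductive limits -/

/-- The union `⋃ n, A n` of a sequence of subspaces. -/
def InductiveLimit {M : Type v} (A : ℕ → Set M) : Type v := {x : M // ∃ n, x ∈ A n}

namespace InductiveLimit

variable {M : Type v}

/-- The inclusion `A n ↪ ⋃ k, A k`. -/
def ofMem (A : ℕ → Set M) (n : ℕ) (x : A n) : InductiveLimit A := ⟨x, n, x.2⟩

/-- The inclusion `⋃ n, A n ↪ M`. -/
def val (A : ℕ → Set M) (x : InductiveLimit A) : M := x.1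

/-- The inductive limit topology: the finest topology for which all the inclusions
`A n ↪ ⋃ k, A k` are continuous. -/
instance [TopologicalSpace M] (A : ℕ → Set M) : TopologicalSpace (InductiveLimit A) :=
  ⨆ n, TopologicalSpace.coinduced (ofMem A n) inferInstance

end InductiveLimit

/-- A map is a homotopy equivalence. -/
def IsHomotopyEquivalence {X Y : Type*} [TopologicalSpace X] [TopologicalSpace Y]
    (f : X → Y) : Prop :=
  ∃ e : ContinuousMap.HomotopyEquiv X Y, (e.toFun : X → Y) = f

/-! ### Flags, Fredholm maps and transversality -/

/-- A `Δ`-flag `A` in a Banach space, `Δ = δ`. -/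
structure IsFlag {E : Type u} [NormedAddCommGroup E] [NormedSpace ℝ E]
    (δ : ℕ → ℕ) (A : ℕ → Submodule ℝ E) : Prop where
  strictMono : StrictMono δ
  isClosed : ∀ n, IsClosed (A n : Set E)
  finiteDimensional : ∀ n, FiniteDimensional ℝ (A n)
  finrank_eq : ∀ n, Module.finrank ℝ (A n) = δ n
  le_succ : ∀ n, A n ≤ A (n + 1)
  dense : Dense (⋃ n, (A n : Set E))
  exists_complements : ∃ C : ℕ → Submodule ℝ E,
    (∀ n, IsClosed (C n : Set E) ∧ IsCompl (A n) (C n)) ∧ ∀ n, C (n + 1) ≤ C n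

section Fredholm

variable {E : Type u} [NormedAddCommGroup E] [NormedSpace ℝ E]
  {M : Type v} [TopologicalSpace M] [ChartedSpace E M]
  {E' : Type w} [NormedAddCommGroup E'] [NormedSpace ℝ E']

/-- A smooth map `f : M → E'` is a Fredholm map of index zero: each differential is a Fredholm
operator whose kernel and cokernel have equal dimension. -/
def IsFredholmMapOfIndexZero (f : M → E') : Prop :=
  ContMDiff 𝓘(ℝ, E) 𝓘(ℝ, E') ∞ f ∧
  ∀ x : M, (mfderiv 𝓘(ℝ, E) 𝓘(ℝ, E') f x).IsFredholm ∧
    Module.finrank ℝ (LinearMap.ker (mfderiv 𝓘(ℝ, E) 𝓘(ℝ, E') f x).toLinearMap) =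
    Module.finrank ℝ (TangentSpace 𝓘(ℝ, E') (f x) ⧸
      LinearMap.range (mfderiv 𝓘(ℝ, E) 𝓘(ℝ, E') f x).toLinearMap)

/-- `f : M → E'` is transverse to the linear subspace `W` of `E'`: wherever `f x ∈ W`, the range
of `df_x` and `W` span `E'` and the preimage of `W` under `df_x` is complemented. (The tangent
space of `E'` at a point is `E'`, and that of `W` is `W`.) -/
def IsTransverseTo (f : M → E') (W : Submodule ℝ E') : Prop :=
  ∀ x : M, f x ∈ W →
    LinearMap.range (mfderiv 𝓘(ℝ, E) 𝓘(ℝ, E') f x).toLinearMap ⊔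
      (show Submodule ℝ (TangentSpace 𝓘(ℝ, E') (f x)) from W) = ⊤ ∧
    (Submodule.comap (mfderiv 𝓘(ℝ, E) 𝓘(ℝ, E') f x).toLinearMap
      (show Submodule ℝ (TangentSpace 𝓘(ℝ, E') (f x)) from W)).ClosedComplemented

end Fredholm

/-! ### Generalized filtrations -/

section Filtration

variable {E : Type u} [NormedAddCommGroup E] [NormedSpace ℝ E]
  {M : Type v} [TopologicalSpace M] [ChartedSpace E M]

/-- `ℱ` is a `Δ`-filtration of `M`, `Δ = δ`. The submanifolds are nonempty (the empty set has no
dimension in `ℕ`). -/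
structure IsDeltaFiltration (δ : ℕ → ℕ) (ℱ : ℕ → ClosedSubmanifold E M) : Prop where
  strictMono : StrictMono δ
  nonempty : ∀ n, (ℱ n).carrier.Nonempty
  dim_eq : ∀ n, (ℱ n).dim = δ n
  subset_succ : ∀ n, (ℱ n).carrier ⊆ (ℱ (n + 1)).carrier
  isHomotopyEquivalence :
    IsHomotopyEquivalence (InductiveLimit.val fun n => (ℱ n).carrier)

/-- `ℱ` is a normal `Δ`-filtration of `M`, `Δ = δ`. -/
structure IsNormalFiltration [IsManifold 𝓘(ℝ, E) ∞ M] (δ : ℕ → ℕ)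
    (ℱ : ℕ → ClosedSubmanifold E M) : Prop extends IsDeltaFiltration δ ℱ where
  trivial_succ : ∀ n,
    HasTrivialNormalBundle (ClosedSubmanifold.inclOfSubset (subset_succ n))
  trivial_ambient : ∀ n, HasTrivialNormalBundle (ℱ n).incl
  exists_tubular : ∃ V U : ℕ → Set M,
    (∀ n, IsTubularNeighborhood (ℱ n) (V n)) ∧ (∀ n, IsOpen (U n)) ∧ (∀ n, U n ⊆ V n) ∧
    (∀ n, U n ⊆ U (n + 1)) ∧ ⋃ n, U n = univ

/-- A filtration is dense if the union of its members is dense in `M`. -/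
def IsDenseFiltration (ℱ : ℕ → ClosedSubmanifold E M) : Prop :=
  Dense (⋃ n, (ℱ n).carrier)

/-- A `Δ`-filtration `ℱ` is Fredholm if `ℱ n = f ⁻¹ (A n)` for a Fredholm map `f` of index zero
from `M` to some Banach space `E'` and a `Δ`-flag `A` of `E'` to which `f` is transverse. -/
def IsFredholmFiltration (δ : ℕ → ℕ) (ℱ : ℕ → ClosedSubmanifold E M) : Prop :=
  ∃ (E' : Type u) (_ : NormedAddCommGroup E') (_ : NormedSpace ℝ E') (_ : CompleteSpace E')
    (f : M → E') (A : ℕ → Submodule ℝ E'),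
    IsFredholmMapOfIndexZero (E := E) f ∧ IsFlag δ A ∧
    ∀ n, IsTransverseTo (E := E) f (A n) ∧ (ℱ n).carrier = f ⁻¹' (A n)

end Filtration

end

/-! All clauses but one are inherited term by term: since `n ≤ φ n`, a subsequence of an increasing
sequence is cofinal, so it has the same union and the same inductive limit (`iUnion_subsequence`,
`InductiveLimit.subsequenceHomeomorph`). The exception is the triviality of the normal bundle of
`M_m` in `M_n` when indices between `m` and `n` are skipped. For `S ⊆ T ⊆ U`, the normal bundle of
`S` in `U` is an extension of the restriction to `S` of `ν(T, U)` by `ν(S, T)`. A smooth splitting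
turns it into a direct sum, and a sum of trivial bundles is trivial. The splitting is the
differential of a smooth retraction onto `T`, supplied by a tubular neighborhood of `T` in `M`. The
lemmas are `cokernelCompEquiv` (fibrewise), `HasTrivialNormalBundle.comp` (smoothness) and
`IsTubularNeighborhood.exists_retraction`; induction on `n` finishes. -/

noncomputable section

/-! ### Quotients by the range of a composition -/

section Quotient

variable {R : Type*} [Ring R]
  {X : Type*} [AddCommGroup X] [Module R X] [TopologicalSpace X]
  {Y : Type*} [AddCommGroup Y] [Module R Y] [TopologicalSpace Y]
  {Z : Type*} [AddCommGroup Z] [Module R Z] [TopologicalSpace Z] [IsTopologicalAddGroup Z]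

/-- If `p` is a left inverse of `b`, then the cokernel of `b ∘ a` is the product of the cokernels
of `a` and `b`. -/
def cokernelCompEquiv [IsTopologicalAddGroup Y]
    (a : X →L[R] Y) (b : Y →L[R] Z) (c : X →L[R] Z) (p : Z →L[R] Y)
    (hc : ∀ x, c x = b (a x)) (hp : ∀ y, p (b y) = y) :
    (Z ⧸ LinearMap.range c.toLinearMap) ≃L[R]
      (Y ⧸ LinearMap.range a.toLinearMap) × (Z ⧸ LinearMap.range b.toLinearMap) :=
  ContinuousLinearEquiv.equivOfInverse
    -- The map is `[z] ↦ ([p z], [z])`, with inverse `([y], [z]) ↦ [b y + (z - b (p z))]`. The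
    -- second summand is well defined because `id - b ∘ p` vanishes on the range of `b`.
    ((Submodule.liftQL _ ((Submodule.mkQL (LinearMap.range a.toLinearMap)).comp p) (by
        rintro _ ⟨x, rfl⟩
        simp [hc, hp])).prod
      (Submodule.liftQL _ (Submodule.mkQL (LinearMap.range b.toLinearMap)) (by
        rintro _ ⟨x, rfl⟩
        simp [hc])))
    ((Submodule.liftQL _ ((Submodule.mkQL (LinearMap.range c.toLinearMap)).comp b) (by
        rintro _ ⟨x, rfl⟩
        simpa using ⟨x, hc x⟩)).coprod
      (Submodule.liftQL _ ((Submodule.mkQL (LinearMap.range c.toLinearMap)).comp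
        (ContinuousLinearMap.id R Z - b.comp p)) (by
        rintro _ ⟨x, rfl⟩
        simp [hp])))
    (by
      intro z
      obtain ⟨z, rfl⟩ := Submodule.mkQ_surjective _ z
      simp)
    (by
      rintro ⟨y, z⟩
      obtain ⟨y, rfl⟩ := Submodule.mkQ_surjective _ y
      obtain ⟨z, rfl⟩ := Submodule.mkQ_surjective _ z
      have hb (y : Y) : (Submodule.Quotient.mk (b y) : Z ⧸ LinearMap.range b.toLinearMap) = 0 :=
        (Submodule.Quotient.mk_eq_zero _).2 ⟨y, rfl⟩
      simp [hp, hb])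

end Quotient

/-! ### Smooth maps into pullback bundles -/

section Pullback

variable {EB : Type*} [NormedAddCommGroup EB] [NormedSpace ℝ EB]
  {B : Type*} [TopologicalSpace B] [ChartedSpace EB B]
  {EB' : Type*} [NormedAddCommGroup EB'] [NormedSpace ℝ EB']
  {B' : Type*} [TopologicalSpace B'] [ChartedSpace EB' B']
  {EN : Type*} [NormedAddCommGroup EN] [NormedSpace ℝ EN]
  {HN : Type*} [TopologicalSpace HN] {J : ModelWithCorners ℝ EN HN}
  {N : Type*} [TopologicalSpace N] [ChartedSpace HN N]
  {F : Type*} [NormedAddCommGroup F] [NormedSpace ℝ F]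
  {A : B → Type*} [∀ x, AddCommGroup (A x)]
  [∀ x, TopologicalSpace (A x)] [TopologicalSpace (TotalSpace F A)] [FiberBundle F A]

/-- The trivializations of the pullback bundle are induced by those of `A`, so the fibre coordinate
does not change and only the base point is moved by `f`. -/
theorem contMDiff_pullback_lift (f : C^∞⟮𝓘(ℝ, EB'), B'; 𝓘(ℝ, EB), B⟯) :
    ContMDiff (𝓘(ℝ, EB').prod 𝓘(ℝ, F)) (𝓘(ℝ, EB).prod 𝓘(ℝ, F)) ∞
      (Pullback.lift (F := F) (E := A) f) := by
  intro p
  have h : ContMDiffAt (𝓘(ℝ, EB').prod 𝓘(ℝ, F)) (𝓘(ℝ, EB').prod 𝓘(ℝ, F)) ∞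
    (id : TotalSpace F ((f : B' → B) *ᵖ A) → _) p := contMDiffAt_id
  rw [contMDiffAt_totalSpace] at h ⊢
  exact ⟨f.contMDiff.contMDiffAt.comp p h.1, h.2⟩

/-- This is the universal property of the pullback as a smooth fibre product. -/
theorem contMDiff_pullback_mk (f : C^∞⟮𝓘(ℝ, EB'), B'; 𝓘(ℝ, EB), B⟯)
    {G : N → TotalSpace F ((f : B' → B) *ᵖ A)}
    (h₁ : ContMDiff J 𝓘(ℝ, EB') ∞ fun x => (G x).proj)
    (h₂ : ContMDiff J (𝓘(ℝ, EB).prod 𝓘(ℝ, F)) ∞ fun x => Pullback.lift f (G x)) :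
    ContMDiff J (𝓘(ℝ, EB').prod 𝓘(ℝ, F)) ∞ G := by
  intro x
  have h := h₂ x
  rw [contMDiffAt_totalSpace] at h ⊢
  exact ⟨h₁ x, h.2⟩

end Pullback

/-! ### Normal bundles of compositions -/

section NormalBundleComp

variable {E₁ : Type w} [NormedAddCommGroup E₁] [NormedSpace ℝ E₁]
  {N₁ : Type*} [TopologicalSpace N₁] [ChartedSpace E₁ N₁]
  {E₂ : Type u} [NormedAddCommGroup E₂] [NormedSpace ℝ E₂]
  {N₂ : Type*} [TopologicalSpace N₂] [ChartedSpace E₂ N₂]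
  {E₃ : Type u} [NormedAddCommGroup E₃] [NormedSpace ℝ E₃]
  {N₃ : Type*} [TopologicalSpace N₃] [ChartedSpace E₃ N₃]

theorem mfderiv_comp_apply_of_contMDiff
    (g : C^∞⟮𝓘(ℝ, E₂), N₂; 𝓘(ℝ, E₃), N₃⟯) (f : C^∞⟮𝓘(ℝ, E₁), N₁; 𝓘(ℝ, E₂), N₂⟯) (x : N₁)
    (v : TangentSpace 𝓘(ℝ, E₁) x) :
    mfderiv 𝓘(ℝ, E₁) 𝓘(ℝ, E₃) (g.comp f) x v =
      mfderiv 𝓘(ℝ, E₂) 𝓘(ℝ, E₃) g (f x) (mfderiv 𝓘(ℝ, E₁) 𝓘(ℝ, E₂) f x v) := by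
  have hf : MDifferentiableAt 𝓘(ℝ, E₁) 𝓘(ℝ, E₂) f x := f.contMDiff.mdifferentiableAt (by simp)
  have hg : MDifferentiableAt 𝓘(ℝ, E₂) 𝓘(ℝ, E₃) g (f x) := g.contMDiff.mdifferentiableAt (by simp)
  exact mfderiv_comp_apply x hg hf v

variable [IsManifold 𝓘(ℝ, E₂) ∞ N₂] [IsManifold 𝓘(ℝ, E₃) ∞ N₃]

/-- If `g` has a smooth left inverse `r` on a neighbourhood of its range, and `f` and `g` have
trivial normal bundles, then so has `g ∘ f`. -/
theorem HasTrivialNormalBundle.comp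
    {g : C^∞⟮𝓘(ℝ, E₂), N₂; 𝓘(ℝ, E₃), N₃⟯} {f : C^∞⟮𝓘(ℝ, E₁), N₁; 𝓘(ℝ, E₂), N₂⟯}
    (hg : HasTrivialNormalBundle g) (hf : HasTrivialNormalBundle f)
    {r : N₃ → N₂} {W : Set N₃} (hW : IsOpen W) (hr : ContMDiffOn 𝓘(ℝ, E₃) 𝓘(ℝ, E₂) ∞ r W)
    (hgW : ∀ y, g y ∈ W) (hrg : ∀ y, r (g y) = y) :
    HasTrivialNormalBundle (g.comp f) := by
  obtain ⟨F, _, _, _, τ, hτ⟩ := hf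
  obtain ⟨F', _, _, _, τ', hτ'⟩ := hg
  -- `dr` at `g y` lands in the tangent space at `r (g y)`; the stated type is accepted because
  -- every `TangentSpace` unfolds to the model space. Differentiating `r ∘ g = id` makes `p y` a
  -- left inverse of `dg`.
  let p (y : N₂) : TangentSpace 𝓘(ℝ, E₃) (g y) →L[ℝ] TangentSpace 𝓘(ℝ, E₂) y :=
    mfderiv 𝓘(ℝ, E₃) 𝓘(ℝ, E₂) r (g y)
  have hp (y : N₂) (v : TangentSpace 𝓘(ℝ, E₂) y) :
      p y (mfderiv 𝓘(ℝ, E₂) 𝓘(ℝ, E₃) g y v) = v := by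
    have hg : MDifferentiableAt 𝓘(ℝ, E₂) 𝓘(ℝ, E₃) g y := g.contMDiff.mdifferentiableAt (by simp)
    have hr' : MDifferentiableAt 𝓘(ℝ, E₃) 𝓘(ℝ, E₂) r (g y) :=
      (hr.contMDiffAt (hW.mem_nhds (hgW y))).mdifferentiableAt (by simp)
    have h := mfderiv_comp_apply y hr' hg v
    have hid : r ∘ g = id := funext hrg
    rw [hid, mfderiv_id] at h
    exact h.symm
  let e (x : N₁) := (cokernelCompEquiv (mfderiv 𝓘(ℝ, E₁) 𝓘(ℝ, E₂) f x)
    (mfderiv 𝓘(ℝ, E₂) 𝓘(ℝ, E₃) g (f x)) (mfderiv 𝓘(ℝ, E₁) 𝓘(ℝ, E₃) (g.comp f) x) (p (f x))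
    (mfderiv_comp_apply_of_contMDiff g f x) (hp (f x))).trans ((τ x).prodCongr (τ' (f x)))
  refine ⟨F × F', inferInstance, inferInstance, inferInstance, e, ?_⟩
  -- The two components of `e` on the class of `q` are the given trivializations evaluated at `G q`
  -- and `G' q`, so it suffices that `G` and `G'` are smooth.
  let G (q : TotalSpace E₃ ((g.comp f : N₁ → N₃) *ᵖ (TangentSpace 𝓘(ℝ, E₃) : N₃ → Type u))) :
      TotalSpace E₂ ((f : N₁ → N₂) *ᵖ (TangentSpace 𝓘(ℝ, E₂) : N₂ → Type u)) :=
    ⟨q.proj, p (f q.proj) q.snd⟩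
  let G' (q : TotalSpace E₃ ((g.comp f : N₁ → N₃) *ᵖ (TangentSpace 𝓘(ℝ, E₃) : N₃ → Type u))) :
      TotalSpace E₃ ((g : N₂ → N₃) *ᵖ (TangentSpace 𝓘(ℝ, E₃) : N₃ → Type u)) :=
    ⟨f q.proj, q.snd⟩
  have hproj : ContMDiff (𝓘(ℝ, E₁).prod 𝓘(ℝ, E₃)) 𝓘(ℝ, E₁) ∞ fun
      q : TotalSpace E₃ ((g.comp f : N₁ → N₃) *ᵖ (TangentSpace 𝓘(ℝ, E₃) : N₃ → Type u)) =>
      q.proj := contMDiff_proj _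
  have hlift := contMDiff_pullback_lift (F := E₃) (A := (TangentSpace 𝓘(ℝ, E₃) : N₃ → Type u))
    (g.comp f)
  have hG' : ContMDiff (𝓘(ℝ, E₁).prod 𝓘(ℝ, E₃)) (𝓘(ℝ, E₂).prod 𝓘(ℝ, E₃)) ∞ G' :=
    contMDiff_pullback_mk g (f.contMDiff.comp hproj) hlift
  have hG : ContMDiff (𝓘(ℝ, E₁).prod 𝓘(ℝ, E₃)) (𝓘(ℝ, E₁).prod 𝓘(ℝ, E₂)) ∞ G := by
    refine contMDiff_pullback_mk f hproj ?_
    -- Followed by the lift to `T N₂`, `G` is the tangent map of `r` along `g ∘ f`.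
    have ht := (hr.contMDiffOn_tangentMapWithin (m := ∞) (by simp) hW.uniqueMDiffOn).comp_contMDiff
      hlift fun q => hgW _
    refine ht.congr fun q => ?_
    have hq : mfderivWithin 𝓘(ℝ, E₃) 𝓘(ℝ, E₂) r W (g (f q.proj)) =
      mfderiv 𝓘(ℝ, E₃) 𝓘(ℝ, E₂) r (g (f q.proj)) := mfderivWithin_of_isOpen hW (hgW _)
    refine TotalSpace.ext (hrg (f q.proj)).symm ?_
    exact heq_of_eq (congrArg (fun l => l q.snd) hq).symm
  exact (hτ.comp hG).prodMk_space (hτ'.comp hG')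

end NormalBundleComp

/-! ### Passing to a subsequence -/

namespace InductiveLimit

variable {M : Type v} [TopologicalSpace M]

theorem continuous_ofMem (A : ℕ → Set M) (n : ℕ) : Continuous (ofMem A n) :=
  continuous_iff_coinduced_le.2 (le_iSup (fun n => TopologicalSpace.coinduced (ofMem A n) _) n)

theorem continuous_of_comp_ofMem {A : ℕ → Set M} {Y : Type*} [TopologicalSpace Y]
    {h : InductiveLimit A → Y} (hh : ∀ n, Continuous (h ∘ ofMem A n)) : Continuous h :=
  continuous_iff_coinduced_le.2 <| by
    erw [coinduced_iSup]
    exact iSup_le fun n => by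
      rw [coinduced_compose]
      exact continuous_iff_coinduced_le.1 (hh n)

/-- The inductive limit of a subsequence of an increasing sequence. -/
def subsequenceHomeomorph {A : ℕ → Set M} (hA : Monotone A) {φ : ℕ → ℕ} (hφ : StrictMono φ) :
    InductiveLimit (fun k => A (φ k)) ≃ₜ InductiveLimit A where
  toFun x := ⟨x.1, x.2.elim fun k hk => ⟨φ k, hk⟩⟩
  invFun x := ⟨x.1, x.2.elim fun n hn => ⟨n, hA hφ.le_apply hn⟩⟩
  left_inv _ := rfl
  right_inv _ := rfl
  continuous_toFun := continuous_of_comp_ofMem fun k => continuous_ofMem A (φ k)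
  continuous_invFun := continuous_of_comp_ofMem fun n =>
    (continuous_ofMem (fun k => A (φ k)) n).comp (continuous_inclusion (hA (hφ.le_apply (x := n))))

end InductiveLimit

theorem iUnion_subsequence {α : Type*} {A : ℕ → Set α} (hA : Monotone A) {φ : ℕ → ℕ}
    (hφ : StrictMono φ) : ⋃ k, A (φ k) = ⋃ n, A n :=
  Subset.antisymm (iUnion_subset fun k => subset_iUnion A (φ k))
    (iUnion_subset fun n => (hA hφ.le_apply).trans (subset_iUnion (fun k => A (φ k)) n))

theorem IsFlag.subsequence {E : Type u} [NormedAddCommGroup E] [NormedSpace ℝ E] {δ : ℕ → ℕ}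
    {A : ℕ → Submodule ℝ E} (hA : IsFlag δ A) {φ : ℕ → ℕ} (hφ : StrictMono φ) :
    IsFlag (fun k => δ (φ k)) (fun k => A (φ k)) where
  strictMono := hA.strictMono.comp hφ
  isClosed k := hA.isClosed _
  finiteDimensional k := hA.finiteDimensional _
  finrank_eq k := hA.finrank_eq _
  le_succ k := monotone_nat_of_le_succ hA.le_succ (hφ.monotone k.le_succ)
  dense := by
    have h : Monotone fun n => (A n : Set E) := monotone_nat_of_le_succ hA.le_succ
    rw [iUnion_subsequence h hφ]
    exact hA.dense
  exists_complements := by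
    obtain ⟨C, hC, hC'⟩ := hA.exists_complements
    exact ⟨fun k => C (φ k), fun k => hC _,
      fun k => antitone_nat_of_succ_le hC' (hφ.monotone k.le_succ)⟩

section Filtration

variable {E : Type u} [NormedAddCommGroup E] [NormedSpace ℝ E]
  {M : Type v} [TopologicalSpace M] [ChartedSpace E M]
  {δ : ℕ → ℕ} {ℱ : ℕ → ClosedSubmanifold E M}

theorem IsTubularNeighborhood.isOpen {S : ClosedSubmanifold E M} {V : Set M}
    (h : IsTubularNeighborhood S V) : IsOpen V := by
  obtain ⟨F, _, _, _, B, _, _, _, _, _, _, _, Φ, rfl, -⟩ := h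
  exact Φ.open_target

/-- A submanifold is a smooth retract of each of its open tubular neighborhoods. -/
theorem IsTubularNeighborhood.exists_retraction {S : ClosedSubmanifold E M} {V : Set M}
    (h : IsTubularNeighborhood S V) :
    ∃ r : M → S.carrier, ContMDiffOn 𝓘(ℝ, E) 𝓘(ℝ, S.Model) ∞ r V ∧
      ∀ x : S.carrier, (x : M) ∈ V ∧ r x = x := by
  obtain ⟨F, _, _, _, B, _, _, _, _, _, _, _, Φ, rfl, -, hΦ, h0⟩ := h
  -- The retraction is the bundle projection read through `Φ`; it fixes `S` because `Φ` carries the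
  -- zero section to `S`.
  refine ⟨fun y => (Φ.symm y).proj, (contMDiff_proj B).comp_contMDiffOn hΦ, fun x => ?_⟩
  obtain ⟨hx, hx'⟩ := h0 x
  exact ⟨hx' ▸ Φ.map_source hx, by simp only [← hx', Φ.left_inv hx]⟩

theorem IsDeltaFiltration.monotone (h : IsDeltaFiltration δ ℱ) :
    Monotone fun n => (ℱ n).carrier :=
  monotone_nat_of_le_succ h.subset_succ

theorem IsDeltaFiltration.subsequence (h : IsDeltaFiltration δ ℱ) {φ : ℕ → ℕ}
    (hφ : StrictMono φ) : IsDeltaFiltration (fun k => δ (φ k)) (fun k => ℱ (φ k)) where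
  strictMono := h.strictMono.comp hφ
  nonempty k := h.nonempty _
  dim_eq k := h.dim_eq _
  subset_succ k := h.monotone (hφ.monotone k.le_succ)
  isHomotopyEquivalence := by
    obtain ⟨e, he⟩ := h.isHomotopyEquivalence
    refine ⟨(InductiveLimit.subsequenceHomeomorph h.monotone hφ).toHomotopyEquiv.trans e, ?_⟩
    funext x
    exact congrFun he _

theorem IsDenseFiltration.subsequence (h : IsDenseFiltration ℱ)
    (hℱ : Monotone fun n => (ℱ n).carrier) {φ : ℕ → ℕ} (hφ : StrictMono φ) :
    IsDenseFiltration (fun k => ℱ (φ k)) := by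
  unfold IsDenseFiltration
  rw [iUnion_subsequence hℱ hφ]
  exact h

theorem IsFredholmFiltration.subsequence (h : IsFredholmFiltration δ ℱ) {φ : ℕ → ℕ}
    (hφ : StrictMono φ) : IsFredholmFiltration (fun k => δ (φ k)) (fun k => ℱ (φ k)) := by
  obtain ⟨E', _, _, _, f, A, hf, hA, hfA⟩ := h
  exact ⟨E', _, _, ‹_›, f, fun k => A (φ k), hf, hA.subsequence hφ, fun k => hfA _⟩

/-- The retraction of `V` onto `T` restricts to the open subset `V ∩ U` of `U`, so a tubular
neighborhood in `M` does the work of one in `U`. -/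
theorem IsTubularNeighborhood.hasTrivialNormalBundle_trans {S T U : ClosedSubmanifold E M}
    {V : Set M} (hV : IsTubularNeighborhood T V) (hST : S.carrier ⊆ T.carrier)
    (hTU : T.carrier ⊆ U.carrier)
    (h₁ : HasTrivialNormalBundle (ClosedSubmanifold.inclOfSubset hST))
    (h₂ : HasTrivialNormalBundle (ClosedSubmanifold.inclOfSubset hTU)) :
    HasTrivialNormalBundle (ClosedSubmanifold.inclOfSubset (hST.trans hTU)) := by
  obtain ⟨r, hr, hrT⟩ := hV.exists_retraction
  have hr' : ContMDiffOn 𝓘(ℝ, U.Model) 𝓘(ℝ, T.Model) ∞ (fun y : U.carrier => r y)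
      (Subtype.val ⁻¹' V) :=
    hr.comp U.incl.contMDiff.contMDiffOn Subset.rfl
  have hcomp : (ClosedSubmanifold.inclOfSubset hTU).comp (ClosedSubmanifold.inclOfSubset hST) =
      ClosedSubmanifold.inclOfSubset (hST.trans hTU) :=
    ContMDiffMap.ext fun _ => rfl
  rw [← hcomp]
  exact h₂.comp h₁ (hV.isOpen.preimage continuous_subtype_val) hr'
    (fun y => (hrT y).1) (fun y => (hrT y).2)

variable [IsManifold 𝓘(ℝ, E) ∞ M]

theorem IsNormalFiltration.hasTrivialNormalBundle (h : IsNormalFiltration δ ℱ) {m n : ℕ}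
    (hmn : m < n) :
    HasTrivialNormalBundle (ClosedSubmanifold.inclOfSubset (h.monotone hmn.le)) := by
  obtain ⟨V, -, hV, -⟩ := h.exists_tubular
  induction n, hmn using Nat.le_induction with
  | base => exact h.trivial_succ m
  -- The intermediate submanifold is `ℱ n`, so its own tubular neighborhood `V n` splits the
  -- extension.
  | succ n hn ih => exact (hV n).hasTrivialNormalBundle_trans _ _ ih (h.trivial_succ n)

theorem IsNormalFiltration.subsequence (h : IsNormalFiltration δ ℱ) {φ : ℕ → ℕ}
    (hφ : StrictMono φ) : IsNormalFiltration (fun k => δ (φ k)) (fun k => ℱ (φ k)) where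
  toIsDeltaFiltration := h.toIsDeltaFiltration.subsequence hφ
  trivial_succ k := h.hasTrivialNormalBundle (hφ k.lt_succ_self)
  trivial_ambient k := h.trivial_ambient _
  exists_tubular := by
    obtain ⟨V, U, hV, hU, hUV, hU', hUM⟩ := h.exists_tubular
    have hU'' : Monotone U := monotone_nat_of_le_succ hU'
    exact ⟨fun k => V (φ k), fun k => U (φ k), fun k => hV _, fun k => hU _, fun k => hUV _,
      fun k => hU'' (hφ.monotone k.le_succ), (iUnion_subsequence hU'' hφ).trans hUM⟩

end Filtration

end

theorem mainTheorem12
    {E : Type u} [NormedAddCommGroup E] [NormedSpace ℝ E] [CompleteSpace E]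
    [TopologicalSpace.SeparableSpace E]
    {M : Type v} [TopologicalSpace M] [ChartedSpace E M] [IsManifold 𝓘(ℝ, E) ∞ M]
    [TopologicalSpace.SeparableSpace M] [TopologicalSpace.MetrizableSpace M] [ConnectedSpace M]
    (δ : ℕ → ℕ) (ℱ : ℕ → ClosedSubmanifold E M) (hℱ : IsNormalFiltration δ ℱ)
    (φ : ℕ → ℕ) (hφ : StrictMono φ) :
    IsNormalFiltration (fun k => δ (φ k)) (fun k => ℱ (φ k)) ∧
    (IsDenseFiltration ℱ → IsDenseFiltration (fun k => ℱ (φ k))) ∧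
    (IsFredholmFiltration δ ℱ →
      IsFredholmFiltration (fun k => δ (φ k)) (fun k => ℱ (φ k))) := by
  exact ⟨hℱ.subsequence hφ, fun h => h.subsequence hℱ.monotone hφ, fun h => h.subsequence hφ⟩
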